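/- Setting. Let $A$, $\Omega$, $M$ be finite sets (actions, states, messages) with $A$ and $\Omega$ nonempty and $|M|>\max\{|\Omega|,|A|\}$, and let $\mu_0$ be a probability distribution on $\Omega$ with $\mu_0(\omega)>0$ for all $\omega$. Sender and Receiver have utilities $u_S,u_R:A\times\Omega\to\mathbb{R}$. A messaging strategy is a map $\sigma:\Omega\to\Delta M$, an action strategy is a map $\rho:M\to\Delta A$, and for $i\in\{S,R\}$ $$U_i(\sigma,\rho)=\sum_{\omega,m,a}\mu_0(\omega)\,\sigma(m|\omega)\,\rho(a|m)\,u_i(a,\omega).$$ Call $(\sigma,\rho)$ R-BR if $\rho$ maximizes $U_R(\sigma,\cdot)$ over all action strategies. A cheap-talk equilibrium is an R-BR profile $(\sigma,\rho)$ such that $\sigma$ maximizes $U_S(\cdot,\rho)$ over all messaging strategies. A curve equilibrium is an R-BR profile $(\sigma,\rho)$ such that $\sigma$ maximizes $U_S(\cdot,\rho)$ over all messaging strategies $\sigma'$ with $\sum_\omega\mu_0(\omega)\sigma'(m|\omega)=\sum_\omega\mu_0(\omega)\sigma(m|\omega)$ for every $m\in M$. A profile is partitional if for every $\omega$ there is an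 $m$ with $\sigma(m|\omega)=1$. The cheap-talk payoff, the curve payoff and the curve partitional payoff are the maximum of $U_S$ over all cheap-talk equilibria, all curve equilibria, and all partitional curve equilibria, respectively. The function $u_S$ is strictly supermodular if there are total orders on $A$ and on $\Omega$ such that $u_S(a',\omega')-u_S(a,\omega')>u_S(a',\omega)-u_S(a,\omega)$ whenever $a'>a$ and $\omega'>\omega$. Theorem. Fix any strictly supermodular $u_S:A\times\Omega\to\mathbb{R}$. The three maxima above exist for every $u_R:A\times\Omega\to\mathbb{R}$, and the set of $u_R\in[0,1]^{A\times\Omega}$ with the following property has Lebesgue measure one: if the curve payoff is strictly higher than the cheap-talk payoff, then the curve payoff is strictly higher than the curve partitional payoff. -/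

import Mathlib

/-!
Sender-Receiver games with finite action set `A`, state space `Ω` and message space `M`.
Utilities are functions `u : A × Ω → ℝ`, and the common prior is a point `μ₀` of the simplex on `Ω`.
-/

namespace SenderReceiver

open MeasureTheory

/-- A strategy from `X` to `Y` assigns to every `x` a probability distribution on `Y`.
Messaging strategies are `Strategy Ω M`, action strategies are `Strategy M A`. -/
abbrev Strategy (X Y : Type*) [Fintype Y] : Type _ := X → stdSimplex ℝ Y

section Game

variable {A Ω M : Type*} [Fintype A] [Fintype Ω] [Fintype M]

/-- The expected payoff of a player with utility `u` under the profile `(σ, ρ)`. -/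
noncomputable def payoff (μ₀ : stdSimplex ℝ Ω) (u : A × Ω → ℝ)
    (σ : Strategy Ω M) (ρ : Strategy M A) : ℝ :=
  ∑ ω : Ω, ∑ m : M, ∑ a : A, μ₀.1 ω * (σ ω).1 m * (ρ m).1 a * u (a, ω)

/-- `(σ, ρ)` is S-BR: `σ` maximises Sender's payoff against `ρ` over all messaging strategies. -/
def IsSenderBR (μ₀ : stdSimplex ℝ Ω) (uS : A × Ω → ℝ)
    (σ : Strategy Ω M) (ρ : Strategy M A) : Prop :=
  ∀ σ' : Strategy Ω M, payoff μ₀ uS σ' ρ ≤ payoff μ₀ uS σ ρ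

/-- `(σ, ρ)` is R-BR: `ρ` maximises Receiver's payoff against `σ` over all action strategies. -/
def IsReceiverBR (μ₀ : stdSimplex ℝ Ω) (uR : A × Ω → ℝ)
    (σ : Strategy Ω M) (ρ : Strategy M A) : Prop :=
  ∀ ρ' : Strategy M A, payoff μ₀ uR σ ρ' ≤ payoff μ₀ uR σ ρ

/-- A cheap-talk equilibrium is a profile that is both S-BR and R-BR. -/
def IsCheapTalkEquilibrium (μ₀ : stdSimplex ℝ Ω) (uS uR : A × Ω → ℝ)
    (σ : Strategy Ω M) (ρ : Strategy M A) : Prop :=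
  IsSenderBR μ₀ uS σ ρ ∧ IsReceiverBR μ₀ uR σ ρ

/-- The messaging strategies that have the same (ex ante) distribution of messages as `σ`. -/
def sameMessageDistribution (μ₀ : stdSimplex ℝ Ω) (σ : Strategy Ω M) : Set (Strategy Ω M) :=
  {σ' | ∀ m : M, ∑ ω : Ω, μ₀.1 ω * (σ' ω).1 m = ∑ ω : Ω, μ₀.1 ω * (σ ω).1 m}

/-- A curve equilibrium: Sender cannot gain from a deviation that preserves the distribution of
messages, and Receiver best responds. -/
def IsCurveEquilibrium (μ₀ : stdSimplex ℝ Ω) (uS uR : A × Ω → ℝ)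
    (σ : Strategy Ω M) (ρ : Strategy M A) : Prop :=
  (∀ σ' ∈ sameMessageDistribution μ₀ σ, payoff μ₀ uS σ' ρ ≤ payoff μ₀ uS σ ρ) ∧
    IsReceiverBR μ₀ uR σ ρ

/-- A messaging strategy is partitional if it sends a single message in every state. -/
def IsPartitional (σ : Strategy Ω M) : Prop :=
  ∀ ω : Ω, ∃ m : M, (σ ω).1 m = 1

/-- Sender's payoffs in cheap-talk equilibria. -/
def cheapTalkPayoffs (M : Type*) [Fintype M] (μ₀ : stdSimplex ℝ Ω) (uS uR : A × Ω → ℝ) : Set ℝ :=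
  {v | ∃ (σ : Strategy Ω M) (ρ : Strategy M A),
    IsCheapTalkEquilibrium μ₀ uS uR σ ρ ∧ payoff μ₀ uS σ ρ = v}

/-- Sender's payoffs in curve equilibria. -/
def curvePayoffs (M : Type*) [Fintype M] (μ₀ : stdSimplex ℝ Ω) (uS uR : A × Ω → ℝ) : Set ℝ :=
  {v | ∃ (σ : Strategy Ω M) (ρ : Strategy M A),
    IsCurveEquilibrium μ₀ uS uR σ ρ ∧ payoff μ₀ uS σ ρ = v}

/-- Sender's payoffs in partitional curve equilibria. -/
def partitionalCurvePayoffs (M : Type*) [Fintype M] (μ₀ : stdSimplex ℝ Ω)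
    (uS uR : A × Ω → ℝ) : Set ℝ :=
  {v | ∃ (σ : Strategy Ω M) (ρ : Strategy M A),
    IsPartitional σ ∧ IsCurveEquilibrium μ₀ uS uR σ ρ ∧ payoff μ₀ uS σ ρ = v}

/-- The cheap-talk payoff: the largest payoff of Sender in a cheap-talk equilibrium. -/
noncomputable def cheapTalkPayoff (M : Type*) [Fintype M] (μ₀ : stdSimplex ℝ Ω)
    (uS uR : A × Ω → ℝ) : ℝ :=
  sSup (cheapTalkPayoffs M μ₀ uS uR)

/-- The curve payoff: the largest payoff of Sender in a curve equilibrium. -/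
noncomputable def curvePayoff (M : Type*) [Fintype M] (μ₀ : stdSimplex ℝ Ω)
    (uS uR : A × Ω → ℝ) : ℝ :=
  sSup (curvePayoffs M μ₀ uS uR)

/-- The curve partitional payoff: the largest payoff of Sender in a partitional curve
equilibrium. -/
noncomputable def curvePartitionalPayoff (M : Type*) [Fintype M] (μ₀ : stdSimplex ℝ Ω)
    (uS uR : A × Ω → ℝ) : ℝ :=
  sSup (partitionalCurvePayoffs M μ₀ uS uR)

/-- Sender values committing to a curve. -/
def ValuesCommittingToCurve (M : Type*) [Fintype M] (μ₀ : stdSimplex ℝ Ω)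
    (uS uR : A × Ω → ℝ) : Prop :=
  cheapTalkPayoff M μ₀ uS uR < curvePayoff M μ₀ uS uR

/-- Curve-committed Sender values randomization. -/
def CurveCommittedValuesRandomization (M : Type*) [Fintype M] (μ₀ : stdSimplex ℝ Ω)
    (uS uR : A × Ω → ℝ) : Prop :=
  curvePartitionalPayoff M μ₀ uS uR < curvePayoff M μ₀ uS uR

end Game

/-- `u` is strictly supermodular with respect to some total orders on `A` and `Ω`. -/
def StrictlySupermodular {A Ω : Type*} (u : A × Ω → ℝ) : Prop :=
  ∃ (_ : LinearOrder A) (_ : LinearOrder Ω), ∀ (a a' : A) (ω ω' : Ω), a < a' → ω < ω' →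
    u (a', ω) - u (a, ω) < u (a', ω') - u (a, ω')

/-- A set of Receiver's preferences is generic if it is a (Lebesgue measurable) subset of
`[0,1]^(A × Ω)` of Lebesgue measure one. -/
def IsGeneric {A Ω : Type*} [Fintype A] [Fintype Ω] (G : Set (A × Ω → ℝ)) : Prop :=
  G ⊆ Set.Icc 0 1 ∧ NullMeasurableSet G volume ∧ volume G = 1

end SenderReceiver

open SenderReceiver

/-! Suppose a partitional curve equilibrium attains the curve payoff; for almost every `uR` it then
yields a cheap-talk equilibrium with the same payoff, so curve commitment has no value.

Outside the null set of ties (`ae_noConditionalTies`), Receiver has a unique best reply to each used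
message of a partitional strategy. Hence the outcome is an assignment of actions to states, and by
supermodularity curve optimality makes it monotone (`monotone_of_curveBR`). If no state prefers the
action of another state, the profile is a cheap-talk equilibrium once unused messages are answered
like used ones.

Otherwise some state `ω₁` prefers the action of some `ω₂`, and the pair can be chosen so that
letting `ω₁` mix between the two actions keeps the assignment comonotone
(`exists_adjacent_improvement`). Comonotonicity provides a transfer `ψ` on actions certifying curve
optimality (`exists_potential`, `payoff_le_of_potential`). A small enough shift of `ω₁` preserves
Receiver's strict best replies (`exists_shift_isReceiverBR`), so it gives a curve equilibrium with a
higher payoff, a contradiction. -/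

namespace SenderReceiver

/-! ### Comonotone assignments and supporting transfers. -/

section Potential

theorem exists_separating_real {ι : Type*} [Finite ι] (g : ι → ℝ) (p q : ι → Prop)
    (h : ∀ i j, p i → q j → g i ≤ g j) : ∃ d, (∀ i, p i → g i ≤ d) ∧ ∀ j, q j → d ≤ g j := by
  by_cases hp : ∃ i, p i
  · obtain ⟨i, hi, hmax⟩ := Set.exists_max_image {i | p i} g (Set.toFinite _) hp
    exact ⟨g i, hmax, fun j hj => h i j hi hj⟩
  · by_cases hq : ∃ j, q j
    · obtain ⟨j, hj, hmin⟩ := Set.exists_min_image {j | q j} g (Set.toFinite _) hq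
      exact ⟨g j, fun i hi => (hp ⟨i, hi⟩).elim, hmin⟩
    · exact ⟨0, fun i hi => (hp ⟨i, hi⟩).elim, fun j hj => (hq ⟨j, hj⟩).elim⟩

/-- A comonotone correspondence `ω ↦ [lo ω, hi ω]` is rationalised by a transfer `ψ`. -/
theorem exists_potential {A Ω : Type*} [Finite A] [Finite Ω] [LinearOrder A] [LinearOrder Ω]
    {u : A × Ω → ℝ}
    (hu : ∀ (a a' : A) (ω ω' : Ω), a < a' → ω < ω' →
      u (a', ω) - u (a, ω) < u (a', ω') - u (a, ω'))
    (lo hi : Ω → A) (h : ∀ ω ω', ω < ω' → hi ω ≤ lo ω') :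
    ∃ ψ : A → ℝ, ∀ ω a b, lo ω ≤ b → b ≤ hi ω → u (a, ω) - ψ a ≤ u (b, ω) - ψ b := by
  classical
  have := Fintype.ofFinite A
  let : SuccOrder A := SuccOrder.ofLinearWellFoundedLT A
  let : LocallyFiniteOrder A := Fintype.toLocallyFiniteOrder
  -- `d b` is the increment of `ψ` from `b` to its successor. States with `lo ω ≤ b` must not gain
  -- by climbing, those with `b < hi ω` must not lose; comonotonicity puts the former weakly below
  -- the latter, so supermodularity separates their marginal utilities.
  have hd : ∀ b : A, ∃ d : ℝ,
      (∀ ω, lo ω ≤ b → u (Order.succ b, ω) - u (b, ω) ≤ d) ∧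
      ∀ ω, b < hi ω → d ≤ u (Order.succ b, ω) - u (b, ω) := by
    intro b
    refine exists_separating_real (fun ω => u (Order.succ b, ω) - u (b, ω)) _ _ ?_
    intro ω ω' h1 h2
    have hle : ω ≤ ω' := by
      by_contra hlt
      exact absurd (h _ _ (not_le.mp hlt)) (not_le.mpr (h1.trans_lt h2))
    rcases hle.eq_or_lt with rfl | hlt
    · exact le_rfl
    · exact (hu _ _ _ _ (Order.lt_succ_of_not_isMax (not_isMax_of_lt h2)) hlt).le
  choose d hd1 hd2 using hd
  let ψ : A → ℝ := fun a => ∑ b with b < a, d b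
  have hψ : ∀ a, ¬ IsMax a → ψ (Order.succ a) = ψ a + d a := by
    intro a ha
    have : (Finset.univ.filter (· < Order.succ a)) = insert a (Finset.univ.filter (· < a)) := by
      ext b
      simp [Order.lt_succ_iff_of_not_isMax ha, le_iff_eq_or_lt]
    simp only [ψ]
    rw [this, Finset.sum_insert (by simp), add_comm]
  refine ⟨ψ, fun ω a b h1 h2 => ?_⟩
  -- Net utility rises up to `hi ω` and falls from `lo ω` on, hence is maximal on the whole interval
  -- between them.
  have hmono : MonotoneOn (fun a => u (a, ω) - ψ a) (Set.Iic (hi ω)) := by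
    refine monotoneOn_of_le_succ Set.ordConnected_Iic fun a ha _ h3 => ?_
    have := hd2 a ω ((Order.lt_succ_of_not_isMax ha).trans_le h3)
    rw [hψ a ha]
    linarith
  have hanti : AntitoneOn (fun a => u (a, ω) - ψ a) (Set.Ici (lo ω)) := by
    refine antitoneOn_of_succ_le Set.ordConnected_Ici fun a ha h3 _ => ?_
    have := hd1 a ω h3
    rw [hψ a ha]
    linarith
  rcases le_total a b with hab | hab
  · exact hmono (hab.trans h2) h2 hab
  · exact hanti h1 (h1.trans hab) hab

/-- Take `ω₁` the largest state envying a higher action, and `h ω₂` the lowest higher action it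
envies. A state above `ω₁` with action below `h ω₂` would either envy `h ω₂` itself, by
supermodularity, or offer `ω₁` a lower improvement. -/
theorem exists_adjacent_improvement_of_lt {A Ω : Type*} [Finite A] [Finite Ω] [LinearOrder A]
    [LinearOrder Ω] {u : A × Ω → ℝ}
    (hu : ∀ (a a' : A) (ω ω' : Ω), a < a' → ω < ω' →
      u (a', ω) - u (a, ω) < u (a', ω') - u (a, ω'))
    {h : Ω → A} (hmono : ∀ ω ω', ω < ω' → h ω ≤ h ω')
    (hne : ∃ ω ω', h ω < h ω' ∧ u (h ω, ω) < u (h ω', ω)) :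
    ∃ ω₁ ω₂, u (h ω₁, ω₁) < u (h ω₂, ω₁) ∧ ∃ ψ : A → ℝ,
      (∀ ω a, u (a, ω) - ψ a ≤ u (h ω, ω) - ψ (h ω)) ∧
      ∀ a, u (a, ω₁) - ψ a ≤ u (h ω₂, ω₁) - ψ (h ω₂) := by
  obtain ⟨ω₁, hω₁, hmax⟩ := Set.exists_max_image
    {ω | ∃ ω', h ω < h ω' ∧ u (h ω, ω) < u (h ω', ω)} id (Set.toFinite _) hne
  obtain ⟨ω₂, ⟨hlt, himp⟩, hmin⟩ := Set.exists_min_image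
    {ω' | h ω₁ < h ω' ∧ u (h ω₁, ω₁) < u (h ω', ω₁)} h (Set.toFinite _) hω₁
  have habove : ∀ ω, ω₁ < ω → h ω₂ ≤ h ω := by
    intro ω hω
    by_contra hcon
    have hcon := not_le.mp hcon
    have hs := hu _ _ _ _ hcon hω
    rcases le_or_gt (u (h ω, ω₁)) (u (h ω₂, ω₁)) with hle | hgt
    · exact absurd (hmax ω ⟨ω₂, hcon, by linarith⟩) (not_le.mpr hω)
    · have h1 : u (h ω₁, ω₁) < u (h ω, ω₁) := himp.trans hgt
      have h2 : h ω₁ ≠ h ω := fun he => by rw [he] at h1; exact h1.false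
      exact absurd (hmin ω ⟨lt_of_le_of_ne (hmono _ _ hω) h2, h1⟩) (not_le.mpr hcon)
  -- Only the interval of `ω₁` is widened, to `[h ω₁, h ω₂]`.
  obtain ⟨ψ, hψ⟩ := exists_potential hu h (Function.update h ω₁ (h ω₂)) (by
    intro ω ω' hω
    by_cases he : ω = ω₁
    · subst he
      simpa using habove _ hω
    · simpa [Function.update_of_ne he] using hmono _ _ hω)
  refine ⟨ω₁, ω₂, himp, ψ, fun ω a => hψ ω a _ le_rfl ?_, fun a => hψ ω₁ a _ hlt.le (by simp)⟩
  by_cases he : ω = ω₁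
  · subst he
    simpa using hlt.le
  · simp [Function.update_of_ne he]

/-- If some state prefers the action of another state under a monotone assignment `h`, then some
state can be split between its action and a better one without destroying comonotonicity. -/
theorem exists_adjacent_improvement {A Ω : Type*} [Finite A] [Finite Ω] [LinearOrder A]
    [LinearOrder Ω] {u : A × Ω → ℝ}
    (hu : ∀ (a a' : A) (ω ω' : Ω), a < a' → ω < ω' →
      u (a', ω) - u (a, ω) < u (a', ω') - u (a, ω'))
    {h : Ω → A} (hmono : ∀ ω ω', ω < ω' → h ω ≤ h ω')
    (hne : ∃ ω ω', u (h ω, ω) < u (h ω', ω)) :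
    ∃ ω₁ ω₂, u (h ω₁, ω₁) < u (h ω₂, ω₁) ∧ ∃ ψ : A → ℝ,
      (∀ ω a, u (a, ω) - ψ a ≤ u (h ω, ω) - ψ (h ω)) ∧
      ∀ a, u (a, ω₁) - ψ a ≤ u (h ω₂, ω₁) - ψ (h ω₂) := by
  obtain ⟨ω, ω', hlt⟩ := hne
  rcases lt_trichotomy (h ω) (h ω') with h1 | h1 | h1
  · exact exists_adjacent_improvement_of_lt hu hmono ⟨ω, ω', h1, hlt⟩
  · rw [h1] at hlt
    exact hlt.false.elim
  -- Reversing both orders preserves strict supermodularity and turns envy of a lower action into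
  -- envy of a higher one.
  · exact exists_adjacent_improvement_of_lt (A := Aᵒᵈ) (Ω := Ωᵒᵈ) (u := u) (h := h)
      (fun a a' ω ω' ha hω => by
        have := hu a' a ω' ω ha hω
        change u (a', ω) - u (a, ω) < u (a', ω') - u (a, ω')
        linarith)
      (fun ω ω' hω => hmono ω' ω hω) ⟨ω, ω', h1, hlt⟩

end Potential

/-! ### Existence of the maxima by compactness. -/

section Maxima

variable {A Ω M : Type*} [Fintype A] [Fintype Ω] [Fintype M]

theorem continuous_payoff {Z : Type*} [TopologicalSpace Z] (μ₀ : stdSimplex ℝ Ω) (u : A × Ω → ℝ)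
    {s : Z → Strategy Ω M} {r : Z → Strategy M A} (hs : Continuous s) (hr : Continuous r) :
    Continuous fun z => payoff μ₀ u (s z) (r z) := by
  have h1 : ∀ ω m, Continuous fun z => (s z ω).1 m := fun ω m =>
    (continuous_apply m).comp (continuous_subtype_val.comp ((continuous_apply ω).comp hs))
  have h2 : ∀ m a, Continuous fun z => (r z m).1 a := fun m a =>
    (continuous_apply a).comp (continuous_subtype_val.comp ((continuous_apply m).comp hr))
  unfold payoff
  exact continuous_finsetSum _ fun ω _ => continuous_finsetSum _ fun m _ =>
    continuous_finsetSum _ fun a _ => ((continuous_const.mul (h1 ω m)).mul (h2 m a)).mul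
      continuous_const

theorem isGreatest_sSup_payoffs (μ₀ : stdSimplex ℝ Ω) (u : A × Ω → ℝ)
    (P : Strategy Ω M → Strategy M A → Prop)
    (hP : IsClosed {p : Strategy Ω M × Strategy M A | P p.1 p.2}) (hne : ∃ σ ρ, P σ ρ) :
    IsGreatest {v | ∃ σ ρ, P σ ρ ∧ payoff μ₀ u σ ρ = v}
      (sSup {v | ∃ σ ρ, P σ ρ ∧ payoff μ₀ u σ ρ = v}) := by
  have himage : {v | ∃ σ ρ, P σ ρ ∧ payoff μ₀ u σ ρ = v} =
      (fun p : Strategy Ω M × Strategy M A => payoff μ₀ u p.1 p.2) '' {p | P p.1 p.2} := by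
    ext v
    simp
  rw [himage]
  obtain ⟨σ, ρ, h⟩ := hne
  exact (hP.isCompact.image (continuous_payoff μ₀ u continuous_fst continuous_snd)).isGreatest_sSup
    ⟨_, (σ, ρ), h, rfl⟩

theorem isClosed_isReceiverBR (μ₀ : stdSimplex ℝ Ω) (uR : A × Ω → ℝ) :
    IsClosed {p : Strategy Ω M × Strategy M A | IsReceiverBR μ₀ uR p.1 p.2} := by
  simp only [IsReceiverBR, Set.ofPred_forall]
  exact isClosed_iInter fun ρ' => isClosed_le
    (continuous_payoff μ₀ uR continuous_fst continuous_const)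
    (continuous_payoff μ₀ uR continuous_fst continuous_snd)

theorem isClosed_isSenderBR (μ₀ : stdSimplex ℝ Ω) (uS : A × Ω → ℝ) :
    IsClosed {p : Strategy Ω M × Strategy M A | IsSenderBR μ₀ uS p.1 p.2} := by
  simp only [IsSenderBR, Set.ofPred_forall]
  exact isClosed_iInter fun σ' => isClosed_le
    (continuous_payoff μ₀ uS continuous_const continuous_snd)
    (continuous_payoff μ₀ uS continuous_fst continuous_snd)

omit [Fintype Ω] in
theorem isClosed_isPartitional :
    IsClosed {p : Strategy Ω M × Strategy M A | IsPartitional p.1} := by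
  simp only [IsPartitional, Set.ofPred_forall, Set.ofPred_exists]
  exact isClosed_iInter fun ω => isClosed_iUnion_of_finite fun m => isClosed_eq
    ((continuous_apply m).comp (continuous_subtype_val.comp
      ((continuous_apply ω).comp continuous_fst))) continuous_const

/-- If `τ` puts at least half as much weight as `σ` everywhere, half of the move from `σ` to `σ'`
can be carried out starting from `τ`. -/
noncomputable def halfShift (σ σ' τ : Strategy Ω M)
    (h : ∀ ω m, (σ ω).1 m / 2 ≤ (τ ω).1 m) : Strategy Ω M := fun ω =>
  ⟨fun m => (τ ω).1 m + ((σ' ω).1 m - (σ ω).1 m) / 2, by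
    intro m
    have := h ω m
    have := (σ' ω).2.1 m
    linarith, by
    rw [Finset.sum_add_distrib, ← Finset.sum_div, Finset.sum_sub_distrib, (σ ω).2.2, (σ' ω).2.2,
      (τ ω).2.2]
    norm_num⟩

theorem payoff_halfShift (μ₀ : stdSimplex ℝ Ω) (u : A × Ω → ℝ) (σ σ' τ : Strategy Ω M)
    (h : ∀ ω m, (σ ω).1 m / 2 ≤ (τ ω).1 m) (ρ : Strategy M A) :
    payoff μ₀ u (halfShift σ σ' τ h) ρ =
      payoff μ₀ u τ ρ + (payoff μ₀ u σ' ρ - payoff μ₀ u σ ρ) / 2 := by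
  simp only [payoff, halfShift, ← Finset.sum_sub_distrib, Finset.sum_div, ← Finset.sum_add_distrib]
  refine Finset.sum_congr rfl fun ω _ => Finset.sum_congr rfl fun m _ =>
    Finset.sum_congr rfl fun a _ => ?_
  ring

theorem halfShift_mem_sameMessageDistribution (μ₀ : stdSimplex ℝ Ω) {σ σ' : Strategy Ω M}
    (τ : Strategy Ω M) (h : ∀ ω m, (σ ω).1 m / 2 ≤ (τ ω).1 m)
    (hσ' : σ' ∈ sameMessageDistribution μ₀ σ) :
    halfShift σ σ' τ h ∈ sameMessageDistribution μ₀ τ := by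
  intro m
  have h1 : ∑ ω, μ₀.1 ω * (halfShift σ σ' τ h ω).1 m = ∑ ω, μ₀.1 ω * (τ ω).1 m +
      (∑ ω, μ₀.1 ω * (σ' ω).1 m - ∑ ω, μ₀.1 ω * (σ ω).1 m) / 2 := by
    rw [← Finset.sum_sub_distrib, Finset.sum_div, ← Finset.sum_add_distrib]
    refine Finset.sum_congr rfl fun ω _ => ?_
    simp only [halfShift]
    ring
  rw [h1, hσ' m, sub_self, zero_div, add_zero]

/-- The set of admissible deviations varies with the strategy, so this is not an intersection of
fixed closed conditions. Instead, a profitable deviation from `σ` is transplanted at half size to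
every nearby strategy, and half of the gain survives. -/
theorem isClosed_curveBR (μ₀ : stdSimplex ℝ Ω) (uS : A × Ω → ℝ) :
    IsClosed {p : Strategy Ω M × Strategy M A |
      ∀ σ' ∈ sameMessageDistribution μ₀ p.1, payoff μ₀ uS σ' p.2 ≤ payoff μ₀ uS p.1 p.2} := by
  rw [← isOpen_compl_iff, isOpen_iff_mem_nhds]
  rintro ⟨σ, ρ⟩ hp
  simp only [Set.mem_compl_iff, Set.mem_ofPred_eq, not_forall, not_le] at hp
  obtain ⟨σ', hσ', hlt⟩ := hp
  have h1 : ∀ᶠ p : Strategy Ω M × Strategy M A in nhds (σ, ρ),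
      payoff μ₀ uS σ p.2 < payoff μ₀ uS σ' p.2 :=
    (continuous_payoff μ₀ uS continuous_const continuous_snd).continuousAt.eventually_lt
      (continuous_payoff μ₀ uS continuous_const continuous_snd).continuousAt hlt
  have h2 : ∀ᶠ p : Strategy Ω M × Strategy M A in nhds (σ, ρ),
      ∀ ω m, (σ ω).1 m / 2 ≤ (p.1 ω).1 m := by
    refine Filter.eventually_all.2 fun ω => Filter.eventually_all.2 fun m => ?_
    rcases ((σ ω).2.1 m).eq_or_lt with h0 | h0
    · refine Filter.Eventually.of_forall fun p => ?_
      have h0' : (σ ω).1 m = 0 := h0.symm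
      rw [h0', zero_div]
      exact (p.1 ω).2.1 m
    · have hc : Continuous fun p : Strategy Ω M × Strategy M A => (p.1 ω).1 m :=
        (continuous_apply m).comp (continuous_subtype_val.comp
          ((continuous_apply ω).comp continuous_fst))
      exact ((hc.tendsto (σ, ρ)).eventually_const_lt (half_lt_self h0)).mono fun p hp => hp.le
  filter_upwards [h1, h2] with p hp1 hp2 hcon
  have := hcon _ (halfShift_mem_sameMessageDistribution μ₀ p.1 hp2 hσ')
  rw [payoff_halfShift] at this
  linarith

/-- The strategy that answers `x` with `f x` for sure. -/
noncomputable def pureStrategy {X Y : Type*} [Fintype Y] (f : X → Y) : Strategy X Y := by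
  classical exact fun x => ⟨Pi.single (f x) 1, single_mem_stdSimplex ℝ (f x)⟩

omit [Fintype Ω] in
theorem isPartitional_pureStrategy (f : Ω → M) : IsPartitional (pureStrategy f) := fun ω =>
  ⟨f ω, by simp [pureStrategy]⟩

theorem sum_pureStrategy {X Y : Type*} [Fintype Y] (f : X → Y) (x : X) (c : Y → ℝ) :
    ∑ y, (pureStrategy f x).1 y * c y = c (f x) := by
  classical
  simp [pureStrategy, Pi.single_apply]

theorem eq_pureStrategy {X Y : Type*} [Fintype Y] {s : Strategy X Y} {f : X → Y}
    (h : ∀ x, (s x).1 (f x) = 1) : s = pureStrategy f := by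
  classical
  funext x
  refine Subtype.ext (funext fun y => ?_)
  by_cases hy : y = f x
  · subst hy
    simp [pureStrategy, h]
  · have h1 := (s x).2.2
    rw [← Finset.add_sum_erase _ _ (Finset.mem_univ (f x)), h x] at h1
    have h2 := (Finset.sum_eq_zero_iff_of_nonneg (fun i _ => (s x).2.1 i)).1
      (show ∑ y ∈ Finset.univ.erase (f x), (s x).1 y = 0 by linarith) y (by simp [hy])
    rw [h2]
    simp [pureStrategy, hy]

/-- Receiver's expected utility from `a`, summed over the event that she gets message `m`. -/
noncomputable def messageValue (μ₀ : stdSimplex ℝ Ω) (u : A × Ω → ℝ) (σ : Strategy Ω M)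
    (m : M) (a : A) : ℝ :=
  ∑ ω, μ₀.1 ω * (σ ω).1 m * u (a, ω)

theorem payoff_eq_sum_messageValue (μ₀ : stdSimplex ℝ Ω) (u : A × Ω → ℝ) (σ : Strategy Ω M)
    (ρ : Strategy M A) :
    payoff μ₀ u σ ρ = ∑ m, ∑ a, (ρ m).1 a * messageValue μ₀ u σ m a := by
  simp only [payoff, messageValue, Finset.mul_sum]
  rw [Finset.sum_comm]
  refine Finset.sum_congr rfl fun m _ => ?_
  rw [Finset.sum_comm]
  refine Finset.sum_congr rfl fun a _ => Finset.sum_congr rfl fun ω _ => ?_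
  ring

theorem isReceiverBR_pureStrategy {μ₀ : stdSimplex ℝ Ω} {uR : A × Ω → ℝ} {σ : Strategy Ω M}
    {α : M → A} (h : ∀ m a, messageValue μ₀ uR σ m a ≤ messageValue μ₀ uR σ m (α m)) :
    IsReceiverBR μ₀ uR σ (pureStrategy α) := by
  intro ρ'
  rw [payoff_eq_sum_messageValue, payoff_eq_sum_messageValue]
  refine Finset.sum_le_sum fun m _ => ?_
  rw [sum_pureStrategy]
  calc ∑ a, (ρ' m).1 a * messageValue μ₀ uR σ m a
      ≤ ∑ a, (ρ' m).1 a * messageValue μ₀ uR σ m (α m) :=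
        Finset.sum_le_sum fun a _ => mul_le_mul_of_nonneg_left (h m a) ((ρ' m).2.1 a)
    _ = messageValue μ₀ uR σ m (α m) := by rw [← Finset.sum_mul, (ρ' m).2.2, one_mul]

omit [Fintype A] in
theorem messageValue_pureStrategy [DecidableEq M] (μ₀ : stdSimplex ℝ Ω) (u : A × Ω → ℝ)
    (f : Ω → M) (m : M) (a : A) :
    messageValue μ₀ u (pureStrategy f) m a = ∑ ω with f ω = m, μ₀.1 ω * u (a, ω) := by
  rw [messageValue, Finset.sum_filter]
  refine Finset.sum_congr rfl fun ω _ => ?_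
  by_cases h : f ω = m
  · subst h
    simp [pureStrategy]
  · simp [pureStrategy, h, Ne.symm h]

/-- Babbling makes all three sets of equilibrium payoffs nonempty at once. -/
theorem exists_babbling_equilibrium [Nonempty A] [Nonempty M] (μ₀ : stdSimplex ℝ Ω)
    (uS uR : A × Ω → ℝ) : ∃ (σ : Strategy Ω M) (ρ : Strategy M A),
      IsPartitional σ ∧ IsCheapTalkEquilibrium μ₀ uS uR σ ρ := by
  classical
  obtain ⟨a₀, ha₀⟩ := Finite.exists_max fun a : A => ∑ ω, μ₀.1 ω * uR (a, ω)
  let m₀ : M := Classical.arbitrary M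
  refine ⟨pureStrategy fun _ => m₀, pureStrategy fun _ => a₀, isPartitional_pureStrategy _,
    fun σ' => le_of_eq ?_, isReceiverBR_pureStrategy fun m a => ?_⟩
  · have h : ∀ σ : Strategy Ω M, payoff μ₀ uS σ (pureStrategy fun _ => a₀) =
        ∑ ω, μ₀.1 ω * uS (a₀, ω) := by
      intro σ
      rw [payoff_eq_sum_messageValue]
      simp only [sum_pureStrategy, messageValue]
      rw [Finset.sum_comm]
      refine Finset.sum_congr rfl fun ω _ => ?_
      rw [← Finset.sum_mul, ← Finset.mul_sum, (σ ω).2.2, mul_one]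
    rw [h, h]
  · rw [messageValue_pureStrategy, messageValue_pureStrategy]
    by_cases h : m₀ = m
    · simpa [h] using ha₀ a
    · simp [h]

theorem IsCheapTalkEquilibrium.isCurveEquilibrium {μ₀ : stdSimplex ℝ Ω} {uS uR : A × Ω → ℝ}
    {σ : Strategy Ω M} {ρ : Strategy M A} (h : IsCheapTalkEquilibrium μ₀ uS uR σ ρ) :
    IsCurveEquilibrium μ₀ uS uR σ ρ :=
  ⟨fun σ' _ => h.1 σ', h.2⟩

theorem isGreatest_cheapTalkPayoff [Nonempty A] [Nonempty M] (μ₀ : stdSimplex ℝ Ω)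
    (uS uR : A × Ω → ℝ) :
    IsGreatest (cheapTalkPayoffs M μ₀ uS uR) (cheapTalkPayoff M μ₀ uS uR) := by
  obtain ⟨σ, ρ, -, h⟩ := exists_babbling_equilibrium (M := M) μ₀ uS uR
  exact isGreatest_sSup_payoffs μ₀ uS _
    ((isClosed_isSenderBR μ₀ uS).inter (isClosed_isReceiverBR μ₀ uR)) ⟨σ, ρ, h⟩

theorem isGreatest_curvePayoff [Nonempty A] [Nonempty M] (μ₀ : stdSimplex ℝ Ω)
    (uS uR : A × Ω → ℝ) :
    IsGreatest (curvePayoffs M μ₀ uS uR) (curvePayoff M μ₀ uS uR) := by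
  obtain ⟨σ, ρ, -, h⟩ := exists_babbling_equilibrium (M := M) μ₀ uS uR
  exact isGreatest_sSup_payoffs μ₀ uS _
    ((isClosed_curveBR μ₀ uS).inter (isClosed_isReceiverBR μ₀ uR)) ⟨σ, ρ, h.isCurveEquilibrium⟩

theorem isGreatest_curvePartitionalPayoff [Nonempty A] [Nonempty M] (μ₀ : stdSimplex ℝ Ω)
    (uS uR : A × Ω → ℝ) :
    IsGreatest (partitionalCurvePayoffs M μ₀ uS uR) (curvePartitionalPayoff M μ₀ uS uR) := by
  obtain ⟨σ, ρ, hσ, h⟩ := exists_babbling_equilibrium (M := M) μ₀ uS uR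
  have := isGreatest_sSup_payoffs μ₀ uS
    (fun (σ : Strategy Ω M) (ρ : Strategy M A) => IsPartitional σ ∧ IsCurveEquilibrium μ₀ uS uR σ ρ)
    (isClosed_isPartitional.inter
      ((isClosed_curveBR μ₀ uS).inter (isClosed_isReceiverBR μ₀ uR)))
    ⟨σ, ρ, hσ, h.isCurveEquilibrium⟩
  simpa only [and_assoc, curvePartitionalPayoff, partitionalCurvePayoffs] using this

end Maxima

/-! ### Ties are Lebesgue null. -/

section Generic

open MeasureTheory

variable {A Ω : Type*} [Fintype A] [Fintype Ω]

/-- No two actions give Receiver the same expected utility conditional on a nonempty event. -/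
def NoConditionalTies (μ₀ : stdSimplex ℝ Ω) (uR : A × Ω → ℝ) : Prop :=
  ∀ (S : Finset Ω) (a a' : A), S.Nonempty → a ≠ a' →
    ∑ ω ∈ S, μ₀.1 ω * uR (a, ω) ≠ ∑ ω ∈ S, μ₀.1 ω * uR (a', ω)

/-- A tie is the kernel of a linear functional, nonzero because the indicator of action `a` is
mapped to the prior mass of `S`. -/
theorem volume_tie_eq_zero {μ₀ : stdSimplex ℝ Ω} (hμ₀ : ∀ ω, 0 < μ₀.1 ω) {S : Finset Ω}
    {a a' : A} (hS : S.Nonempty) (ha : a ≠ a') :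
    volume {uR : A × Ω → ℝ | ∑ ω ∈ S, μ₀.1 ω * uR (a, ω) = ∑ ω ∈ S, μ₀.1 ω * uR (a', ω)} = 0 := by
  classical
  let L : (A × Ω → ℝ) →ₗ[ℝ] ℝ :=
    ∑ ω ∈ S, μ₀.1 ω • (LinearMap.proj (R := ℝ) (φ := fun _ : A × Ω => ℝ) (a, ω) -
      LinearMap.proj (R := ℝ) (φ := fun _ : A × Ω => ℝ) (a', ω))
  have hL : ∀ x, L x = ∑ ω ∈ S, μ₀.1 ω * x (a, ω) - ∑ ω ∈ S, μ₀.1 ω * x (a', ω) := by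
    intro x
    simp [L, mul_sub, Finset.sum_sub_distrib]
  have hset : {uR : A × Ω → ℝ | ∑ ω ∈ S, μ₀.1 ω * uR (a, ω) = ∑ ω ∈ S, μ₀.1 ω * uR (a', ω)} =
      (LinearMap.ker L : Set (A × Ω → ℝ)) := by
    ext x
    simp [hL, sub_eq_zero]
  rw [hset]
  refine Measure.addHaar_submodule _ _ fun htop => ?_
  have h1 : L (fun p => if p.1 = a then 1 else 0) = 0 := by
    rw [LinearMap.ker_eq_top.1 htop, LinearMap.zero_apply]
  rw [hL] at h1
  simp only [if_true, mul_one, if_neg ha.symm, mul_zero, Finset.sum_const_zero, sub_zero] at h1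
  exact (Finset.sum_pos (fun ω _ => hμ₀ ω) hS).ne' h1

theorem ae_noConditionalTies {μ₀ : stdSimplex ℝ Ω} (hμ₀ : ∀ ω, 0 < μ₀.1 ω) :
    ∀ᵐ uR : A × Ω → ℝ, NoConditionalTies μ₀ uR := by
  simp only [NoConditionalTies, ae_all_iff]
  intro S a a' hS ha
  exact measure_eq_zero_iff_ae_notMem.1 (volume_tie_eq_zero hμ₀ hS ha)

theorem isGeneric_of_ae {P : (A × Ω → ℝ) → Prop} (h : ∀ᵐ uR, P uR) :
    IsGeneric {uR : A × Ω → ℝ | uR ∈ Set.Icc 0 1 ∧ P uR} := by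
  have hae : {uR : A × Ω → ℝ | uR ∈ Set.Icc 0 1 ∧ P uR} =ᵐ[volume] Set.Icc (0 : A × Ω → ℝ) 1 := by
    filter_upwards [h] with x hx
    exact propext (and_iff_left hx)
  refine ⟨fun x hx => hx.1, measurableSet_Icc.nullMeasurableSet.congr hae.symm, ?_⟩
  rw [measure_congr hae, Real.volume_Icc_pi]
  simp

end Generic

/-! ### Perturbing messaging strategies, and optimality by transfers. -/

section Shift

variable {A Ω M : Type*} [Fintype A] [Fintype Ω] [Fintype M]

/-- The expectation of `c ω m` when states are drawn from `μ₀` and messages from `σ`. -/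
noncomputable def expectation (μ₀ : stdSimplex ℝ Ω) (c : Ω → M → ℝ) (σ : Strategy Ω M) : ℝ :=
  ∑ ω, μ₀.1 ω * ∑ m, (σ ω).1 m * c ω m

theorem expectation_pureStrategy (μ₀ : stdSimplex ℝ Ω) (c : Ω → M → ℝ) (f : Ω → M) :
    expectation μ₀ c (pureStrategy f) = ∑ ω, μ₀.1 ω * c ω (f ω) := by
  simp only [expectation, sum_pureStrategy]

theorem payoff_pureStrategy (μ₀ : stdSimplex ℝ Ω) (u : A × Ω → ℝ) (σ : Strategy Ω M)
    (α : M → A) :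
    payoff μ₀ u σ (pureStrategy α) = expectation μ₀ (fun ω m => u (α m, ω)) σ := by
  rw [payoff_eq_sum_messageValue]
  simp only [sum_pureStrategy]
  simp only [messageValue, expectation, Finset.mul_sum]
  rw [Finset.sum_comm]
  refine Finset.sum_congr rfl fun ω _ => Finset.sum_congr rfl fun m _ => ?_
  ring

omit [Fintype A] in
theorem messageValue_eq_expectation [DecidableEq M] (μ₀ : stdSimplex ℝ Ω) (u : A × Ω → ℝ)
    (σ : Strategy Ω M) (m : M) (a : A) :
    messageValue μ₀ u σ m a = expectation μ₀ (fun ω m' => if m' = m then u (a, ω) else 0) σ := by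
  simp [messageValue, expectation, mul_assoc]

theorem messageProbability_eq_expectation [DecidableEq M] (μ₀ : stdSimplex ℝ Ω)
    (σ : Strategy Ω M) (m : M) :
    ∑ ω, μ₀.1 ω * (σ ω).1 m = expectation μ₀ (fun _ m' => if m' = m then 1 else 0) σ := by
  simp [expectation]

/-- In state `ω`, move the fraction `s` of the probability to message `m`. -/
noncomputable def shift (σ : Strategy Ω M) (ω : Ω) (m : M) (s : ℝ) (hs : s ∈ Set.Icc (0 : ℝ) 1) :
    Strategy Ω M :=
  open scoped Classical in
  Function.update σ ω ⟨(1 - s) • (σ ω).1 + s • Pi.single m 1,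
    convex_stdSimplex ℝ M (σ ω).2 (single_mem_stdSimplex ℝ m) (sub_nonneg.2 hs.2) hs.1 (by ring)⟩

omit [Fintype Ω] in
theorem shift_of_ne (σ : Strategy Ω M) {ω ω' : Ω} (m : M) {s : ℝ} (hs : s ∈ Set.Icc (0 : ℝ) 1)
    (h : ω' ≠ ω) : shift σ ω m s hs ω' = σ ω' := by
  classical exact Function.update_of_ne h _ _

/-- Payoffs against pure replies, message values and message probabilities are all expectations, so
this one formula tracks them all. -/
theorem expectation_shift (μ₀ : stdSimplex ℝ Ω) (c : Ω → M → ℝ) (σ : Strategy Ω M) (ω : Ω) (m : M)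
    {s : ℝ} (hs : s ∈ Set.Icc (0 : ℝ) 1) :
    expectation μ₀ c (shift σ ω m s hs) =
      expectation μ₀ c σ + s * (μ₀.1 ω * (c ω m - ∑ m', (σ ω).1 m' * c ω m')) := by
  classical
  have h1 : ∑ m', (shift σ ω m s hs ω).1 m' * c ω m' =
      ∑ m', (σ ω).1 m' * c ω m' + s * (c ω m - ∑ m', (σ ω).1 m' * c ω m') := by
    simp only [shift, Function.update_self, Pi.add_apply, Pi.smul_apply, smul_eq_mul, add_mul,
      Finset.sum_add_distrib, mul_assoc, ← Finset.mul_sum]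
    simp only [Pi.single_apply, ite_mul, one_mul, zero_mul, Finset.sum_ite_eq', Finset.mem_univ,
      if_true]
    ring
  have h2 : ∑ ω' ∈ Finset.univ.erase ω, μ₀.1 ω' * ∑ m', (shift σ ω m s hs ω').1 m' * c ω' m' =
      ∑ ω' ∈ Finset.univ.erase ω, μ₀.1 ω' * ∑ m', (σ ω').1 m' * c ω' m' :=
    Finset.sum_congr rfl fun ω' hω' => by rw [shift_of_ne σ m hs (Finset.ne_of_mem_erase hω')]
  rw [expectation, expectation, ← Finset.add_sum_erase _ _ (Finset.mem_univ ω),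
    ← Finset.add_sum_erase _ _ (Finset.mem_univ ω), h1, h2]
  ring

theorem expectation_shift_pureStrategy (μ₀ : stdSimplex ℝ Ω) (c : Ω → M → ℝ) (f : Ω → M) (ω : Ω)
    (m : M) {s : ℝ} (hs : s ∈ Set.Icc (0 : ℝ) 1) :
    expectation μ₀ c (shift (pureStrategy f) ω m s hs) =
      expectation μ₀ c (pureStrategy f) + s * (μ₀.1 ω * (c ω m - c ω (f ω))) := by
  rw [expectation_shift, sum_pureStrategy]

/-- A messaging strategy supported on maximisers of `u (α m, ω) - ψ m` is curve optimal. -/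
theorem payoff_le_of_potential {μ₀ : stdSimplex ℝ Ω} {u : A × Ω → ℝ} {σ τ : Strategy Ω M}
    {α : M → A} (ψ : M → ℝ)
    (h : expectation μ₀ (fun ω m => u (α m, ω) - ψ m) τ ≤
      expectation μ₀ (fun ω m => u (α m, ω) - ψ m) σ)
    (hτ : τ ∈ sameMessageDistribution μ₀ σ) :
    payoff μ₀ u τ (pureStrategy α) ≤ payoff μ₀ u σ (pureStrategy α) := by
  -- The transfers enter only through the distribution of messages, which `τ` and `σ` share.
  have key : ∀ υ : Strategy Ω M, expectation μ₀ (fun ω m => u (α m, ω) - ψ m) υ =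
      payoff μ₀ u υ (pureStrategy α) - ∑ m, (∑ ω, μ₀.1 ω * (υ ω).1 m) * ψ m := by
    intro υ
    rw [payoff_pureStrategy]
    simp only [expectation, mul_sub, Finset.sum_sub_distrib, Finset.mul_sum, Finset.sum_mul]
    congr 1
    rw [Finset.sum_comm]
    refine Finset.sum_congr rfl fun m _ => Finset.sum_congr rfl fun ω _ => ?_
    ring
  rw [key, key, Finset.sum_congr rfl fun m _ => by rw [hτ m]] at h
  linarith

end Shift

/-! ### From an optimal partitional curve equilibrium to cheap talk. -/

section Main

variable {A Ω M : Type*} [Fintype A] [Fintype Ω] [Fintype M]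

theorem apply_eq_one_of_isReceiverBR {μ₀ : stdSimplex ℝ Ω} {uR : A × Ω → ℝ} {σ : Strategy Ω M}
    {ρ : Strategy M A} (h : IsReceiverBR μ₀ uR σ ρ) {m : M} {b : A}
    (hb : ∀ a, a ≠ b → messageValue μ₀ uR σ m a < messageValue μ₀ uR σ m b) :
    (ρ m).1 b = 1 := by
  classical
  have h1 := h (Function.update ρ m (pureStrategy (fun _ : M => b) m))
  have hrest : ∑ m' ∈ Finset.univ.erase m,
      ∑ a, (Function.update ρ m (pureStrategy (fun _ : M => b) m) m').1 a *
        messageValue μ₀ uR σ m' a =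
      ∑ m' ∈ Finset.univ.erase m, ∑ a, (ρ m').1 a * messageValue μ₀ uR σ m' a :=
    Finset.sum_congr rfl fun m' hm' => by
      rw [Function.update_of_ne (Finset.ne_of_mem_erase hm')]
  rw [payoff_eq_sum_messageValue, payoff_eq_sum_messageValue,
    ← Finset.add_sum_erase _ _ (Finset.mem_univ m),
    ← Finset.add_sum_erase (a := m) _ (fun m => ∑ a, (ρ m).1 a * messageValue μ₀ uR σ m a)
      (Finset.mem_univ m), hrest] at h1
  have h2 := le_of_add_le_add_right h1
  rw [Function.update_self, sum_pureStrategy] at h2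
  have h3 : ∑ a, (ρ m).1 a * (messageValue μ₀ uR σ m b - messageValue μ₀ uR σ m a) ≤ 0 := by
    simp only [mul_sub, Finset.sum_sub_distrib, ← Finset.sum_mul]
    rw [(ρ m).2.2]
    linarith
  have hle : ∀ a, messageValue μ₀ uR σ m a ≤ messageValue μ₀ uR σ m b := fun a => by
    by_cases hab : a = b
    · rw [hab]
    · exact (hb a hab).le
  have hnn : ∀ a ∈ Finset.univ,
      0 ≤ (ρ m).1 a * (messageValue μ₀ uR σ m b - messageValue μ₀ uR σ m a) := fun a _ =>
    mul_nonneg ((ρ m).2.1 a) (sub_nonneg.2 (hle a))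
  have h4 := (Finset.sum_eq_zero_iff_of_nonneg hnn).1 (h3.antisymm (Finset.sum_nonneg hnn))
  rw [← (ρ m).2.2, eq_comm]
  refine Finset.sum_eq_single b (fun a ha hab => ?_) fun hb' => (hb' (Finset.mem_univ b)).elim
  exact (mul_eq_zero.1 (h4 a ha)).resolve_right (sub_pos.2 (hb a hab)).ne'

theorem exists_strict_best_action [Nonempty A] {μ₀ : stdSimplex ℝ Ω} {uR : A × Ω → ℝ}
    (hR : NoConditionalTies μ₀ uR) (f : Ω → M) (ω : Ω) :
    ∃ b, ∀ a, a ≠ b → messageValue μ₀ uR (pureStrategy f) (f ω) a <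
      messageValue μ₀ uR (pureStrategy f) (f ω) b := by
  classical
  obtain ⟨b, hb⟩ := Finite.exists_max fun a => messageValue μ₀ uR (pureStrategy f) (f ω) a
  refine ⟨b, fun a hab => lt_of_le_of_ne (hb a) ?_⟩
  rw [messageValue_pureStrategy, messageValue_pureStrategy]
  exact hR _ a b ⟨ω, by simp⟩ hab

/-- With strict best responses on path, a partitional curve equilibrium can be supported by a pure
action strategy that reacts to unused messages as to some used message. -/
theorem exists_pure_representation [Nonempty A] {μ₀ : stdSimplex ℝ Ω} (hμ₀ : ∀ ω, 0 < μ₀.1 ω)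
    {uS uR : A × Ω → ℝ} (hR : NoConditionalTies μ₀ uR) {f : Ω → M} {ρ : Strategy M A}
    (h : IsCurveEquilibrium μ₀ uS uR (pureStrategy f) ρ) :
    ∃ α : M → A, (∀ m, ∃ ω, α m = α (f ω)) ∧
      (∀ ω a, a ≠ α (f ω) → messageValue μ₀ uR (pureStrategy f) (f ω) a <
        messageValue μ₀ uR (pureStrategy f) (f ω) (α (f ω))) ∧
      ∀ τ ∈ sameMessageDistribution μ₀ (pureStrategy f),
        payoff μ₀ uS τ ρ = payoff μ₀ uS τ (pureStrategy α) := by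
  classical
  have hbest : ∀ m, ∃ b, (∃ ω, f ω = m) → ∀ a, a ≠ b →
      messageValue μ₀ uR (pureStrategy f) m a < messageValue μ₀ uR (pureStrategy f) m b := by
    intro m
    by_cases hm : ∃ ω, f ω = m
    · obtain ⟨ω, rfl⟩ := hm
      obtain ⟨b, hb⟩ := exists_strict_best_action hR f ω
      exact ⟨b, fun _ => hb⟩
    · exact ⟨Classical.arbitrary A, fun hm' => (hm hm').elim⟩
  choose β hβ using hbest
  obtain ⟨ω₀⟩ : Nonempty Ω := by
    by_contra hΩ
    have := μ₀.2.2
    rw [not_nonempty_iff] at hΩ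
    simp at this
  -- Answering unused messages with an on-path action gives Sender no new temptation; the arbitrary
  -- values of `β` are never used.
  let α : M → A := fun m => if ∃ ω, f ω = m then β m else β (f ω₀)
  have hα : ∀ ω, α (f ω) = β (f ω) := fun ω => if_pos ⟨ω, rfl⟩
  refine ⟨α, fun m => ?_, fun ω a ha => ?_, fun τ hτ => ?_⟩
  · by_cases hm : ∃ ω, f ω = m
    · obtain ⟨ω, rfl⟩ := hm
      exact ⟨ω, rfl⟩
    · exact ⟨ω₀, (if_neg hm).trans (hα ω₀).symm⟩
  · rw [hα] at ha ⊢
    exact hβ _ ⟨ω, rfl⟩ a ha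
  · rw [payoff_eq_sum_messageValue, payoff_eq_sum_messageValue]
    refine Finset.sum_congr rfl fun m _ => ?_
    by_cases hm : ∃ ω, f ω = m
    · have hone : (ρ m).1 (β m) = 1 := apply_eq_one_of_isReceiverBR h.2 (hβ m hm)
      have heq : (fun _ : Unit => ρ m) = pureStrategy fun _ => α m :=
        eq_pureStrategy fun _ => by rw [show α m = β m from if_pos hm]; exact hone
      rw [show ρ m = pureStrategy α m from congrFun heq ()]
    -- An unused message keeps probability zero under `τ`, so by full support no state sends it and
    -- the reply to it is irrelevant.
    · have hzero : ∀ ω, (τ ω).1 m = 0 := by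
        have h0 : ∑ ω, μ₀.1 ω * (τ ω).1 m = 0 := by
          rw [hτ m]
          refine Finset.sum_eq_zero fun ω _ => ?_
          have : m ≠ f ω := fun hmf => hm ⟨ω, hmf.symm⟩
          simp [pureStrategy, this]
        intro ω
        have := (Finset.sum_eq_zero_iff_of_nonneg fun ω _ =>
          mul_nonneg (hμ₀ ω).le ((τ ω).2.1 m)).1 h0 ω (Finset.mem_univ ω)
        exact (mul_eq_zero.1 this).resolve_left (hμ₀ ω).ne'
      simp [messageValue, hzero]

/-- If two states had actions in reverse order, swapping equal prior mass `t` between their messages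
would preserve the message distribution and gain by supermodularity. -/
theorem monotone_of_curveBR [LinearOrder A] [LinearOrder Ω] {μ₀ : stdSimplex ℝ Ω}
    (hμ₀ : ∀ ω, 0 < μ₀.1 ω) {u : A × Ω → ℝ}
    (hu : ∀ (a a' : A) (ω ω' : Ω), a < a' → ω < ω' →
      u (a', ω) - u (a, ω) < u (a', ω') - u (a, ω'))
    {f : Ω → M} {α : M → A}
    (h : ∀ τ ∈ sameMessageDistribution μ₀ (pureStrategy f),
      payoff μ₀ u τ (pureStrategy α) ≤ payoff μ₀ u (pureStrategy f) (pureStrategy α))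
    (ω ω' : Ω) (hω : ω < ω') : α (f ω) ≤ α (f ω') := by
  classical
  by_contra hcon
  have hs := hu _ _ _ _ (not_le.mp hcon) hω
  obtain ⟨t, ht, h1, h2⟩ : ∃ t : ℝ, 0 < t ∧ t ≤ μ₀.1 ω ∧ t ≤ μ₀.1 ω' :=
    ⟨min (μ₀.1 ω) (μ₀.1 ω'), lt_min (hμ₀ ω) (hμ₀ ω'), min_le_left _ _, min_le_right _ _⟩
  have hs1 : t / μ₀.1 ω ∈ Set.Icc (0 : ℝ) 1 :=
    ⟨(div_pos ht (hμ₀ ω)).le, (div_le_one (hμ₀ ω)).2 h1⟩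
  have hs2 : t / μ₀.1 ω' ∈ Set.Icc (0 : ℝ) 1 :=
    ⟨(div_pos ht (hμ₀ ω')).le, (div_le_one (hμ₀ ω')).2 h2⟩
  let τ := shift (shift (pureStrategy f) ω (f ω') _ hs1) ω' (f ω) _ hs2
  have hτ : ∀ c : Ω → M → ℝ, expectation μ₀ c τ = expectation μ₀ c (pureStrategy f) +
      t * (c ω (f ω') - c ω (f ω) + (c ω' (f ω) - c ω' (f ω'))) := by
    intro c
    simp only [τ]
    rw [expectation_shift, shift_of_ne _ _ _ hω.ne', sum_pureStrategy,
      expectation_shift_pureStrategy, ← mul_assoc, ← mul_assoc, div_mul_cancel₀ _ (hμ₀ ω).ne',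
      div_mul_cancel₀ _ (hμ₀ ω').ne']
    ring
  have hmem : τ ∈ sameMessageDistribution μ₀ (pureStrategy f) := by
    intro m
    rw [messageProbability_eq_expectation, messageProbability_eq_expectation, hτ]
    ring
  have hle := h τ hmem
  rw [payoff_pureStrategy, payoff_pureStrategy, hτ] at hle
  have : 0 < t * (u (α (f ω'), ω) - u (α (f ω), ω) + (u (α (f ω), ω') - u (α (f ω'), ω'))) :=
    mul_pos ht (by linarith)
  linarith

theorem isSenderBR_of_no_envy {μ₀ : stdSimplex ℝ Ω} {u : A × Ω → ℝ} {f : Ω → M} {α : M → A}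
    (h : ∀ ω m, u (α m, ω) ≤ u (α (f ω), ω)) :
    IsSenderBR μ₀ u (pureStrategy f) (pureStrategy α) := by
  intro τ
  rw [payoff_pureStrategy, payoff_pureStrategy, expectation_pureStrategy]
  refine Finset.sum_le_sum fun ω _ => mul_le_mul_of_nonneg_left ?_ (μ₀.2.1 ω)
  calc ∑ m, (τ ω).1 m * u (α m, ω) ≤ ∑ m, (τ ω).1 m * u (α (f ω), ω) :=
        Finset.sum_le_sum fun m _ => mul_le_mul_of_nonneg_left (h ω m) ((τ ω).2.1 m)
    _ = u (α (f ω), ω) := by rw [← Finset.sum_mul, (τ ω).2.2, one_mul]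

/-- Strict best responses of Receiver survive small shifts to a message in use. -/
theorem exists_shift_isReceiverBR {μ₀ : stdSimplex ℝ Ω} {uR : A × Ω → ℝ} {f : Ω → M} {α : M → A}
    (h : ∀ ω a, a ≠ α (f ω) → messageValue μ₀ uR (pureStrategy f) (f ω) a <
        messageValue μ₀ uR (pureStrategy f) (f ω) (α (f ω))) (ω₁ ω₂ : Ω) :
    ∃ (s : ℝ) (hs : s ∈ Set.Icc (0 : ℝ) 1), 0 < s ∧
      IsReceiverBR μ₀ uR (shift (pureStrategy f) ω₁ (f ω₂) s hs) (pureStrategy α) := by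
  classical
  -- Slope in `s` of Receiver's value of `a` at message `m`; it vanishes at unused messages.
  let K : M → A → ℝ := fun m a => μ₀.1 ω₁ *
    ((if f ω₂ = m then uR (a, ω₁) else 0) - if f ω₁ = m then uR (a, ω₁) else 0)
  have hev : ∀ m a, ∀ᶠ s : ℝ in nhdsWithin 0 (Set.Ioi 0),
      messageValue μ₀ uR (pureStrategy f) m a + s * K m a ≤
        messageValue μ₀ uR (pureStrategy f) m (α m) + s * K m (α m) := by
    intro m a
    by_cases hm : ∃ ω, f ω = m
    · obtain ⟨ω, rfl⟩ := hm
      by_cases ha : a = α (f ω)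
      · rw [← ha]
        exact Filter.Eventually.of_forall fun _ => le_rfl
      · have hc : ∀ b, Continuous fun s : ℝ =>
            messageValue μ₀ uR (pureStrategy f) (f ω) b + s * K (f ω) b := fun b => by fun_prop
        refine Filter.Eventually.filter_mono nhdsWithin_le_nhds ?_
        refine (((hc a).continuousAt (x := 0)).eventually_lt (hc _).continuousAt ?_).mono
          fun s hs => hs.le
        simpa using h ω a ha
    · refine Filter.Eventually.of_forall fun s => le_of_eq ?_
      have hne : ∀ ω, f ω ≠ m := fun ω hω => hm ⟨ω, hω⟩
      simp [messageValue_pureStrategy, K, hne]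
  have hIoc : ∀ᶠ s : ℝ in nhdsWithin 0 (Set.Ioi 0), s ∈ Set.Ioc (0 : ℝ) 1 :=
    Ioc_mem_nhdsGT one_pos
  obtain ⟨s, hs, hsK⟩ := (hIoc.and (Filter.eventually_all.2 fun m =>
    Filter.eventually_all.2 fun a => hev m a)).exists
  have hs' : s ∈ Set.Icc (0 : ℝ) 1 := Set.Ioc_subset_Icc_self hs
  refine ⟨s, hs', hs.1, isReceiverBR_pureStrategy fun m a => ?_⟩
  have hval : ∀ b, messageValue μ₀ uR
      (shift (pureStrategy f) ω₁ (f ω₂) s hs') m b =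
      messageValue μ₀ uR (pureStrategy f) m b + s * K m b := fun b => by
    rw [messageValue_eq_expectation, messageValue_eq_expectation, expectation_shift_pureStrategy]
  rw [hval, hval]
  exact hsK m a

/-- An optimal curve equilibrium that is partitional is a cheap-talk equilibrium, up to Receiver's
reaction to unused messages. -/
theorem exists_isCheapTalkEquilibrium_of_optimal_partitional [Nonempty A] [LinearOrder A]
    [LinearOrder Ω] {μ₀ : stdSimplex ℝ Ω} (hμ₀ : ∀ ω, 0 < μ₀.1 ω) {uS uR : A × Ω → ℝ}
    (hu : ∀ (a a' : A) (ω ω' : Ω), a < a' → ω < ω' →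
      uS (a', ω) - uS (a, ω) < uS (a', ω') - uS (a, ω'))
    (hR : NoConditionalTies μ₀ uR) {σ : Strategy Ω M} {ρ : Strategy M A}
    (hσ : IsPartitional σ) (h : IsCurveEquilibrium μ₀ uS uR σ ρ)
    (hopt : ∀ (σ' : Strategy Ω M) (ρ' : Strategy M A), IsCurveEquilibrium μ₀ uS uR σ' ρ' →
      payoff μ₀ uS σ' ρ' ≤ payoff μ₀ uS σ ρ) :
    ∃ ρ', IsCheapTalkEquilibrium μ₀ uS uR σ ρ' ∧ payoff μ₀ uS σ ρ' = payoff μ₀ uS σ ρ := by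
  choose f hf using hσ
  obtain rfl := eq_pureStrategy hf
  obtain ⟨α, hαf, hstrict, hpay⟩ := exists_pure_representation hμ₀ hR h
  have hself : pureStrategy f ∈ sameMessageDistribution μ₀ (pureStrategy f) := fun _ => rfl
  have hmono := monotone_of_curveBR hμ₀ hu (f := f) (α := α) fun τ hτ => by
    rw [← hpay τ hτ, ← hpay _ hself]
    exact h.1 τ hτ
  refine ⟨pureStrategy α, ⟨isSenderBR_of_no_envy fun ω m => ?_, ?_⟩, (hpay _ hself).symm⟩
  · by_contra hcon
    obtain ⟨ω', hω'⟩ := hαf m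
    rw [hω'] at hcon
    obtain ⟨ω₁, ω₂, himp, ψ, hψ, hψ₁⟩ := exists_adjacent_improvement hu
      (h := fun ω => α (f ω)) hmono ⟨ω, ω', not_le.mp hcon⟩
    obtain ⟨s, hs, hpos, hBR⟩ := exists_shift_isReceiverBR hstrict ω₁ ω₂
    have hcurve : IsCurveEquilibrium μ₀ uS uR (shift (pureStrategy f) ω₁ (f ω₂) s hs)
        (pureStrategy α) := by
      refine ⟨fun τ hτ => payoff_le_of_potential (fun m => ψ (α m)) ?_ hτ, hBR⟩
      rw [expectation_shift_pureStrategy]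
      -- Net of transfers `ω₁` is indifferent between the two messages, so the shifted strategy
      -- still maximizes net utility in every state.
      have h1 : uS (α (f ω₂), ω₁) - ψ (α (f ω₂)) = uS (α (f ω₁), ω₁) - ψ (α (f ω₁)) :=
        (hψ ω₁ _).antisymm (hψ₁ _)
      rw [h1, sub_self, mul_zero, mul_zero, add_zero, expectation_pureStrategy]
      refine Finset.sum_le_sum fun ω _ => mul_le_mul_of_nonneg_left ?_ (μ₀.2.1 ω)
      calc ∑ m, (τ ω).1 m * (uS (α m, ω) - ψ (α m))
          ≤ ∑ m, (τ ω).1 m * (uS (α (f ω), ω) - ψ (α (f ω))) :=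
            Finset.sum_le_sum fun m _ => mul_le_mul_of_nonneg_left (hψ ω _) ((τ ω).2.1 m)
        _ = uS (α (f ω), ω) - ψ (α (f ω)) := by rw [← Finset.sum_mul, (τ ω).2.2, one_mul]
    have hle := hopt _ _ hcurve
    rw [hpay _ hself, payoff_pureStrategy, payoff_pureStrategy,
      expectation_shift_pureStrategy] at hle
    have := mul_pos hpos (mul_pos (hμ₀ ω₁) (sub_pos.2 himp))
    linarith
  · refine isReceiverBR_pureStrategy fun m a => ?_
    classical
    by_cases hm : ∃ ω, f ω = m
    · obtain ⟨ω, rfl⟩ := hm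
      by_cases ha : a = α (f ω)
      · rw [ha]
      · exact (hstrict ω a ha).le
    · have hne : ∀ ω, f ω ≠ m := fun ω hω => hm ⟨ω, hω⟩
      simp [messageValue_pureStrategy, hne]

theorem curveCommittedValuesRandomization_of_noConditionalTies [Nonempty A] [Nonempty M]
    {μ₀ : stdSimplex ℝ Ω} (hμ₀ : ∀ ω, 0 < μ₀.1 ω) {uS uR : A × Ω → ℝ}
    (hu : StrictlySupermodular uS) (hR : NoConditionalTies μ₀ uR)
    (h : ValuesCommittingToCurve M μ₀ uS uR) : CurveCommittedValuesRandomization M μ₀ uS uR := by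
  obtain ⟨_, _, hu⟩ := hu
  by_contra hcon
  obtain ⟨σ, ρ, hσ, hc, hv⟩ := (isGreatest_curvePartitionalPayoff (M := M) μ₀ uS uR).1
  obtain ⟨ρ', hct, hp⟩ := exists_isCheapTalkEquilibrium_of_optimal_partitional hμ₀ hu hR hσ hc
    fun σ' ρ' h' => by
      rw [hv]
      exact ((isGreatest_curvePayoff μ₀ uS uR).2 ⟨σ', ρ', h', rfl⟩).trans (not_lt.mp hcon)
  have h1 : payoff μ₀ uS σ ρ' ≤ cheapTalkPayoff M μ₀ uS uR :=
    (isGreatest_cheapTalkPayoff μ₀ uS uR).2 ⟨σ, ρ', hct, rfl⟩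
  rw [hp, hv] at h1
  exact absurd h (not_lt.mpr ((not_lt.mp hcon).trans h1))

end Main

end SenderReceiver

theorem mainTheorem8 {A Ω M : Type*} [Fintype A] [Nonempty A] [Fintype Ω] [Fintype M]
    (hM : max (Fintype.card Ω) (Fintype.card A) < Fintype.card M)
    (μ₀ : stdSimplex ℝ Ω) (hμ₀ : ∀ ω : Ω, 0 < μ₀.1 ω)
    (uS : A × Ω → ℝ) (huS : StrictlySupermodular uS) :
    -- the maxima that define the three payoffs are attained
    (∀ uR : A × Ω → ℝ,
      IsGreatest (cheapTalkPayoffs M μ₀ uS uR) (cheapTalkPayoff M μ₀ uS uR) ∧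
      IsGreatest (curvePayoffs M μ₀ uS uR) (curvePayoff M μ₀ uS uR) ∧
      IsGreatest (partitionalCurvePayoffs M μ₀ uS uR) (curvePartitionalPayoff M μ₀ uS uR)) ∧
    IsGeneric {uR : A × Ω → ℝ | uR ∈ Set.Icc 0 1 ∧
      (ValuesCommittingToCurve M μ₀ uS uR → CurveCommittedValuesRandomization M μ₀ uS uR)} := by
  have : Nonempty M := Fintype.card_pos_iff.1 ((Nat.zero_le _).trans_lt hM)
  exact ⟨fun uR => ⟨isGreatest_cheapTalkPayoff μ₀ uS uR, isGreatest_curvePayoff μ₀ uS uR,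
    isGreatest_curvePartitionalPayoff μ₀ uS uR⟩,
    isGeneric_of_ae ((ae_noConditionalTies hμ₀).mono fun _ hR =>
      curveCommittedValuesRandomization_of_noConditionalTies hμ₀ huS hR)⟩
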